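/- Let $n\ge 2$ be an integer, let $D$ be an integer with $D^2<4n$, and let $z=\frac D2\pm i\sqrt{n-\left(\frac D2\right)^2}$ (either choice of sign). Then $z$ satisfies $z^2=Dz-n$. A representation of $x\in\mathbb C$ in the numeral system with base $z$ and digits $\{0,1,\dots,n-1\}$ is a sequence $(a_i)_{i\in\mathbb Z}$ with all $a_i\in\{0,\dots,n-1\}$, with $a_i=0$ for all sufficiently large $i$, and with $x=\sum_{i\in\mathbb Z}a_iz^i$. The system is called proper if every $x\in\mathbb C$ has at least one representation and there is a set $S\subset\mathbb C$ of planar Lebesgue measure zero such that every $x\in\mathbb C\setminus S$ has at most one representation. Let $I_z\subset\mathbb C$ be the set of points that have a representation with $a_i=0$ for all $i<0$. Then the system is proper if and only if $D\le 1$. Moreover, $I_z=\mathbb Z+z\mathbb Z$ if and only if $D\le 1$. -/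

import Mathlib

open MeasureTheory

namespace ComplexBase

/-- Digit sequences `(a_i)_{i ∈ ℤ}` with all `a_i ∈ {0, …, n - 1}` and only finitely many
nonzero digits at positive positions. -/
def digitSeqs (n : ℕ) : Set (ℤ → ℕ) :=
  {a | (∀ i, a i < n) ∧ ∃ N : ℤ, ∀ i, N < i → a i = 0}

/-- `a` is a representation of `x` in the system with digits `{0, …, n - 1}` and base `z`:
it is an admissible digit sequence and `∑ i, a_i z ^ i` converges to `x`. -/
def IsRepresentation (n : ℕ) (z : ℂ) (a : ℤ → ℕ) (x : ℂ) : Prop :=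
  a ∈ digitSeqs n ∧ HasSum (fun i : ℤ => (a i : ℂ) * z ^ i) x

/-- The system is proper: every point has a representation, and outside a set of planar
Lebesgue measure zero every point has at most one representation. -/
def IsProper (n : ℕ) (z : ℂ) : Prop :=
  (∀ x : ℂ, ∃ a, IsRepresentation n z a x) ∧
    ∃ S : Set ℂ, volume S = 0 ∧
      ∀ x, x ∉ S → ∀ a b, IsRepresentation n z a x → IsRepresentation n z b x → a = b

/-- The integer part `I_z`: points having a representation without digits at negative positions. -/
def integerPart (n : ℕ) (z : ℂ) : Set ℂ :=
  {x | ∃ a, (∀ i, i < 0 → a i = 0) ∧ IsRepresentation n z a x}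

/-- The set `ℤ + zℤ`. -/
def lattice (z : ℂ) : Set ℂ :=
  {x | ∃ p q : ℤ, x = p + z * q}

end ComplexBase

/-! The root `z` is nonreal with `normSq z = n`, and division by `z` on `ℤ + zℤ` leaves a unique
remainder in `{0, …, n - 1}`. A lattice point is a finite digit string exactly when iterated
division reaches 0.

For `D ≤ 0` this always happens: `n` and `-1` are values of polynomials in `z` with natural
coefficients, so carries can be made without increasing the digit sum (`finRep_aeval`). For `D = 1`
a bounding box of the coordinates shrinks (`finRep_box`). For `D ≥ 2` division has a nonzero fixed
point (`not_finRep`).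

Almost-everywhere uniqueness holds for every `D`: with `K` the fractional part, `z K` has volume `n
* volume K` and is covered by `n` digit translates of `K`, which must overlap in null sets.
Existence for `D ≤ 1` follows by approximating `x` by `z ^ (-k) * l` with lattice points `l` and
using compactness. For `D ≥ 2`, surjectivity would force `K` to be null although countably many
translates of it cover the plane. -/

namespace ComplexBase

/-! ### Finite digit strings and the lattice -/

/-- `x` is the value of a digit string of length `m` in base `z`. -/
def FinRep (n : ℕ) (z : ℂ) (m : ℕ) (x : ℂ) : Prop :=
  ∃ d : ℕ → ℕ, (∀ i, d i < n) ∧ x = ∑ i ∈ Finset.range m, (d i : ℂ) * z ^ i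

theorem FinRep.cons {n : ℕ} {z w : ℂ} {m d : ℕ} (hd : d < n) (h : FinRep n z m w) :
    FinRep n z (m + 1) (d + z * w) := by
  obtain ⟨e, he, rfl⟩ := h
  refine ⟨fun i => if i = 0 then d else e (i - 1), fun i => ?_, ?_⟩
  · dsimp only
    split_ifs
    · exact hd
    · exact he _
  · rw [Finset.sum_range_succ', Finset.mul_sum, add_comm]
    congr 1
    · refine Finset.sum_congr rfl fun i _ => ?_
      simp only [Nat.add_eq_zero_iff, one_ne_zero, and_false, if_false, Nat.add_sub_cancel]
      ring
    · simp

theorem FinRep.uncons {n : ℕ} {z x : ℂ} {m : ℕ} (h : FinRep n z (m + 1) x) :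
    ∃ d < n, ∃ w, FinRep n z m w ∧ x = d + z * w := by
  obtain ⟨e, he, rfl⟩ := h
  refine ⟨e 0, he 0, _, ⟨fun i => e (i + 1), fun i => he _, rfl⟩, ?_⟩
  rw [Finset.sum_range_succ', Finset.mul_sum, add_comm]
  congr 1
  · simp
  · exact Finset.sum_congr rfl fun i _ => by ring

theorem FinRep.mono {n : ℕ} {z x : ℂ} {m m' : ℕ} (h : FinRep n z m x) (hm : m ≤ m') :
    FinRep n z m' x := by
  obtain ⟨e, he, rfl⟩ := h
  refine ⟨fun i => if i < m then e i else 0, fun i => ?_, ?_⟩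
  · dsimp only
    split_ifs
    · exact he _
    · exact (Nat.zero_le _).trans_lt (he 0)
  · have hs : Finset.range m ⊆ Finset.range m' := Finset.range_mono hm
    rw [← Finset.sum_subset hs]
    · refine Finset.sum_congr rfl fun i hi => ?_
      simp [Finset.mem_range.1 hi]
    · intro i _ hi
      simp_all

theorem finRep_zero {n : ℕ} (hn : 0 < n) (z : ℂ) : FinRep n z 0 0 :=
  ⟨fun _ => 0, fun _ => hn, by simp⟩

theorem lattice_add {z x y : ℂ} (hx : x ∈ lattice z) (hy : y ∈ lattice z) :
    x + y ∈ lattice z := by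
  obtain ⟨p, q, rfl⟩ := hx
  obtain ⟨p', q', rfl⟩ := hy
  exact ⟨p + p', q + q', by push_cast; ring⟩

theorem lattice_sub {z x y : ℂ} (hx : x ∈ lattice z) (hy : y ∈ lattice z) :
    x - y ∈ lattice z := by
  obtain ⟨p, q, rfl⟩ := hx
  obtain ⟨p', q', rfl⟩ := hy
  exact ⟨p - p', q - q', by push_cast; ring⟩

theorem lattice_countable (z : ℂ) : (lattice z).Countable := by
  have : lattice z = Set.range fun p : ℤ × ℤ => (p.1 + z * p.2 : ℂ) := by
    ext x
    constructor
    · rintro ⟨p, q, h⟩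
      exact ⟨(p, q), h.symm⟩
    · rintro ⟨⟨p, q⟩, h⟩
      exact ⟨p, q, h.symm⟩
  rw [this]
  exact Set.countable_range _

/-! ### Division by the base in the lattice -/

section Quadratic

variable {n : ℕ} {D : ℤ} {z : ℂ}

theorem re_eq (hz : z ^ 2 = D * z - n) (him : z.im ≠ 0) : z.re = D / 2 := by
  have h := congrArg Complex.im hz
  simp [pow_two] at h
  have : z.im * (2 * z.re - D) = 0 := by linarith
  rcases mul_eq_zero.1 this with h | h
  · exact absurd h him
  · linarith

theorem normSq_eq (hz : z ^ 2 = D * z - n) (him : z.im ≠ 0) : Complex.normSq z = n := by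
  have h := congrArg Complex.re hz
  have h' := re_eq hz him
  simp [pow_two] at h
  rw [Complex.normSq_apply]
  have : (D : ℝ) = 2 * z.re := by linarith
  rw [this] at h
  linarith

theorem sq_lt_four_mul (hz : z ^ 2 = D * z - n) (him : z.im ≠ 0) : D ^ 2 < 4 * (n : ℤ) := by
  have h := normSq_eq hz him
  have h' := re_eq hz him
  rw [Complex.normSq_apply, h'] at h
  have : (D : ℝ) ^ 2 < 4 * n := by nlinarith [mul_self_pos.2 him]
  exact_mod_cast this

theorem mul_mem_lattice (hz : z ^ 2 = D * z - n) {x : ℂ} (hx : x ∈ lattice z) :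
    z * x ∈ lattice z := by
  obtain ⟨p, q, rfl⟩ := hx
  refine ⟨-(n * q), p + q * D, ?_⟩
  push_cast
  linear_combination (q : ℂ) * hz

theorem FinRep.mem_lattice (hz : z ^ 2 = D * z - n) {m : ℕ} {x : ℂ} (h : FinRep n z m x) :
    x ∈ lattice z := by
  induction m generalizing x with
  | zero =>
    obtain ⟨d, -, rfl⟩ := h
    exact ⟨0, 0, by simp⟩
  | succ m ih =>
    obtain ⟨d, -, w, hw, rfl⟩ := h.uncons
    exact lattice_add ⟨d, 0, by simp⟩ (mul_mem_lattice hz (ih hw))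

/-- Division by the base with the digit as remainder. -/
theorem lattice_divide (hz : z ^ 2 = D * z - n) (hn : 2 ≤ n) (p q : ℤ) :
    ∃ d : ℕ, d < n ∧
      (p + z * q : ℂ) = d + z * (((q + p / n * D : ℤ) : ℂ) + z * ((-(p / n) : ℤ) : ℂ)) := by
  have hn0 : (n : ℤ) ≠ 0 := by omega
  obtain ⟨d, hd⟩ := Int.eq_ofNat_of_zero_le (Int.emod_nonneg p hn0)
  have hlt := Int.emod_lt_of_pos p (show (0 : ℤ) < n by omega)
  refine ⟨d, by omega, ?_⟩
  have h := Int.mul_ediv_add_emod p n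
  rw [hd] at h
  have h' : (p : ℂ) = n * ((p / n : ℤ) : ℂ) + d := by exact_mod_cast h.symm
  push_cast
  linear_combination h' + ((p / n : ℤ) : ℂ) * hz

theorem normSq_lattice (hz : z ^ 2 = D * z - n) (him : z.im ≠ 0) (p q : ℤ) :
    Complex.normSq (p + z * q) = ((p ^ 2 + D * p * q + n * q ^ 2 : ℤ) : ℝ) := by
  have h := normSq_eq hz him
  rw [Complex.normSq_apply] at h
  have h' := re_eq hz him
  rw [Complex.normSq_apply]
  simp
  rw [← h]
  have : (D : ℝ) = 2 * z.re := by linarith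
  rw [this]
  ring

theorem aeval_mem_lattice (hz : z ^ 2 = D * z - n) (P : Polynomial ℕ) :
    P.aeval z ∈ lattice z := by
  induction P using Polynomial.induction_on with
  | C a => exact ⟨a, 0, by simp⟩
  | add p q hp hq =>
    rw [map_add]
    exact lattice_add hp hq
  | monomial k a h =>
    have := mul_mem_lattice hz h
    convert this using 1
    simp
    ring

/-- If `n` has a representation without units digit, with nonnegative digits and digit sum `n`,
then all values of polynomials with nonnegative coefficients are representable. -/
theorem finRep_aeval (hz : z ^ 2 = D * z - n) (him : z.im ≠ 0) (hn : 2 ≤ n)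
    (G : Polynomial ℕ) (hG1 : G.eval 1 = n) (hG : z * G.aeval z = n) (S N : ℕ) (P : Polynomial ℕ)
    (hP : P.eval 1 = S) (hN : Complex.normSq (P.aeval z) ≤ N) :
    ∃ m, FinRep n z m (P.aeval z) := by
  -- Lexicographic descent: the digit sum drops when the remainder is nonzero; otherwise the squared
  -- norm, an integer, is divided by `n`.
  induction S using Nat.strong_induction_on generalizing N P with
  | _ S ihS =>
  induction N generalizing P with
  | zero =>
    have : P.aeval z = 0 := by
      rw [← Complex.normSq_eq_zero]
      exact le_antisymm (by simpa using hN) (Complex.normSq_nonneg _)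
    exact ⟨0, this ▸ finRep_zero (by omega) z⟩
  | succ N ihN =>
    set k := P.coeff 0 / n with hk
    set r := P.coeff 0 % n with hr
    have hkr : n * k + r = P.coeff 0 := Nat.div_add_mod _ _
    have hrn : r < n := Nat.mod_lt _ (by omega)
    -- The excess `n * k` in the units place is carried upwards as `k * z * G(z)`, which preserves
    -- the digit sum since `G(1) = n`.
    set Q := P.divX + Polynomial.C k * G with hQ
    have hPx : P = P.divX * Polynomial.X + Polynomial.C (P.coeff 0) :=
      (Polynomial.divX_mul_X_add P).symm
    have hval : P.aeval z = r + z * Q.aeval z := by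
      have h1 : P.aeval z = P.divX.aeval z * z + (P.coeff 0 : ℂ) := by
        conv_lhs => rw [hPx]
        simp
      have h2 : Q.aeval z = P.divX.aeval z + k * G.aeval z := by simp [hQ]
      rw [h1, h2, ← hkr]
      push_cast
      linear_combination -(k : ℂ) * hG
    have hQ1 : Q.eval 1 + r = S := by
      have h1 : P.eval 1 = P.divX.eval 1 + P.coeff 0 := by
        conv_lhs => rw [hPx]
        simp
      have h2 : Q.eval 1 = P.divX.eval 1 + k * n := by simp [hQ, hG1]
      rw [h2, ← hP, h1, ← hkr]
      ring
    by_cases hr0 : r = 0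
    · rw [hval]
      suffices h : ∃ m, FinRep n z m (Q.aeval z) by
        obtain ⟨m, hm⟩ := h
        exact ⟨_, hm.cons hrn⟩
      refine ihN Q (by omega) ?_
      have h1 : Complex.normSq (P.aeval z) = n * Complex.normSq (Q.aeval z) := by
        rw [hval, hr0, Nat.cast_zero, zero_add, Complex.normSq_mul, normSq_eq hz him]
      obtain ⟨p, q, hpq⟩ := aeval_mem_lattice hz Q
      rw [h1] at hN
      have h0 := Complex.normSq_nonneg (Q.aeval z)
      rw [hpq, normSq_lattice hz him] at hN h0 ⊢
      generalize p ^ 2 + D * p * q + n * q ^ 2 = t at *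
      have hN' : (n : ℤ) * t ≤ N + 1 := by exact_mod_cast hN
      have h0' : 0 ≤ t := by exact_mod_cast h0
      have : t ≤ N := by nlinarith
      exact_mod_cast this
    · rw [hval]
      obtain ⟨N', hN'⟩ := exists_nat_ge (Complex.normSq (Q.aeval z))
      obtain ⟨m, hm⟩ := ihS (Q.eval 1) (by omega) N' Q rfl hN'
      exact ⟨_, hm.cons hrn⟩

/-- If moreover `-1` is the value of a polynomial with nonnegative coefficients, then every
lattice point is representable. -/
theorem finRep_of_neg_one (hz : z ^ 2 = D * z - n) (him : z.im ≠ 0) (hn : 2 ≤ n)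
    (G : Polynomial ℕ) (hG1 : G.eval 1 = n) (hG : z * G.aeval z = n)
    (M : Polynomial ℕ) (hM : M.aeval z = -1) {x : ℂ} (hx : x ∈ lattice z) :
    ∃ m, FinRep n z m x := by
  obtain ⟨p, q, rfl⟩ := hx
  have key : ∀ a : ℤ, (a : ℂ) = (a.toNat : ℂ) - ((-a).toNat : ℂ) := fun a => by
    have : a = (a.toNat : ℤ) - ((-a).toNat : ℤ) := by omega
    exact_mod_cast congrArg (Int.cast : ℤ → ℂ) this
  have : (p + z * q : ℂ) = Polynomial.aeval z
      ((Polynomial.C p.toNat + Polynomial.C (-p).toNat * M +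
      Polynomial.X * (Polynomial.C q.toNat + Polynomial.C (-q).toNat * M) : Polynomial ℕ)) := by
    rw [key p, key q]
    simp [hM]
    ring
  rw [this]
  obtain ⟨N, hN⟩ := exists_nat_ge (Complex.normSq (Polynomial.aeval z
    ((Polynomial.C p.toNat + Polynomial.C (-p).toNat * M +
      Polynomial.X * (Polynomial.C q.toNat + Polynomial.C (-q).toNat * M) : Polynomial ℕ))))
  exact finRep_aeval hz him hn G hG1 hG _ N _ rfl hN

/-- With `A = -D`, the equation `z² + Az + n = 0` exhibits `-1`. Multiplied by `z - 1` it gives `n =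
z³ + (A - 1)z² + (n - A)z`, of digit sum `n`. For `A = 0` a coefficient would be negative, so the
multiplier is `z² - 1`. -/
theorem finRep_of_nonpos (hz : z ^ 2 = D * z - n) (him : z.im ≠ 0) (hn : 2 ≤ n) (hD : D ≤ 0)
    {x : ℂ} (hx : x ∈ lattice z) : ∃ m, FinRep n z m x := by
  obtain ⟨A, rfl⟩ : ∃ A : ℕ, D = -(A : ℤ) := ⟨D.natAbs, by omega⟩
  obtain ⟨n', rfl⟩ : ∃ n' : ℕ, n = n' + 1 := ⟨n - 1, by omega⟩
  have hA : A ≤ n' + 1 := by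
    have h := sq_lt_four_mul hz him
    push_cast at h
    by_contra hlt
    have hlt' : (n' : ℤ) + 2 ≤ A := by omega
    nlinarith
  have hM : (Polynomial.X ^ 2 + Polynomial.C A * Polynomial.X + Polynomial.C n' :
      Polynomial ℕ).aeval z = -1 := by
    simp
    push_cast at hz
    linear_combination hz
  rcases Nat.eq_zero_or_pos A with rfl | hpos
  · refine finRep_of_neg_one hz him hn
      (Polynomial.X ^ 3 + Polynomial.C n' * Polynomial.X) ?_ ?_ _ hM hx
    · simp [add_comm]
    · simp
      push_cast at hz
      linear_combination (z ^ 2 - 1) * hz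
  · obtain ⟨A', rfl⟩ : ∃ A', A = A' + 1 := ⟨A - 1, by omega⟩
    obtain ⟨B, rfl⟩ : ∃ B, n' = A' + B := ⟨n' - A', by omega⟩
    refine finRep_of_neg_one hz him hn
      (Polynomial.X ^ 2 + Polynomial.C A' * Polynomial.X + Polynomial.C B) ?_ ?_ _ hM hx
    · simp
      ring
    · simp
      push_cast at hz
      linear_combination (z - 1) * hz

/-- In the coordinates `(u, v)`, division by `z` becomes the recurrence `(u, v) ↦ (v, ⌊(v - u) /
n⌋)`. The boxes `[-s, s]²` and `[-(s+1), s]²` interleave; each is invariant, and iteration falls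
into the preceding one. -/
theorem finRep_box (hz : z ^ 2 = (1 : ℤ) * z - n) (hn : 2 ≤ n) (s : ℕ) :
    (∀ u v : ℤ, -s ≤ u → u ≤ s → -s ≤ v → v ≤ s →
      ∃ m, FinRep n z m ((v - u : ℤ) + z * (-v : ℤ))) ∧
    (∀ u v : ℤ, -(s + 1) ≤ u → u ≤ s → -(s + 1) ≤ v → v ≤ s →
      ∃ m, FinRep n z m ((v - u : ℤ) + z * (-v : ℤ))) := by
  have step : ∀ u v : ℤ, (∃ m, FinRep n z m (((v - u) / n - v : ℤ) + z * (-((v - u) / n) : ℤ))) →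
      ∃ m, FinRep n z m ((v - u : ℤ) + z * (-v : ℤ)) := by
    rintro u v ⟨m, hm⟩
    obtain ⟨d, hd, h⟩ := lattice_divide hz hn (v - u) (-v)
    refine ⟨m + 1, ?_⟩
    rw [h]
    have h' : -v + (v - u) / n * 1 = (v - u) / n - v := by ring
    rw [h']
    exact hm.cons hd
  have key : ∀ a : ℤ, (0 ≤ a → 0 ≤ a / n ∧ 2 * (a / n) ≤ a) ∧
      (a < 0 → a / n ≤ -1 ∧ a - 1 ≤ 2 * (a / n)) := fun a => by
    have h1 := Int.mul_ediv_add_emod a n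
    have h2 := Int.emod_nonneg a (show (n : ℤ) ≠ 0 by omega)
    have h3 := Int.emod_lt_of_pos a (show (0 : ℤ) < n by omega)
    have hn' : (2 : ℤ) ≤ n := by exact_mod_cast hn
    generalize a / n = k at *
    refine ⟨fun ha => ?_, fun ha => ?_⟩
    · have hk : 0 ≤ k := by
        by_contra hk
        nlinarith
      exact ⟨hk, by nlinarith⟩
    · have hk : k ≤ -1 := by
        by_contra hk
        nlinarith
      exact ⟨hk, by nlinarith⟩
  -- An extreme value cannot arise from three consecutive terms `t, u, v`: it would need `u` and `v`
  -- at opposite ends, while `v` at its end needs `u` at the same end. Three divisions thus bring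
  -- both coordinates into `Q`.
  have reduce : ∀ P : ℤ → Prop, (∀ u v, P u → P v → P ((v - u) / n)) →
      ∀ Q : ℤ → Prop, (∀ t u v, P t → P u → P v → v = (u - t) / n → P ((v - u) / n) →
        Q ((v - u) / n)) →
      (∀ u v, Q u → Q v → ∃ m, FinRep n z m ((v - u : ℤ) + z * (-v : ℤ))) →
      ∀ u v, P u → P v → ∃ m, FinRep n z m ((v - u : ℤ) + z * (-v : ℤ)) := by
    intro P hP Q hQ h u v hu hv
    have h2 := hP u v hu hv
    have h3 := hP _ _ hv h2
    have h4 := hP _ _ h2 h3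
    exact step _ _ (step _ _ (step _ _ (h _ _ (hQ _ _ _ hu hv h2 rfl h3)
      (hQ _ _ _ hv h2 h3 rfl h4))))
  have small : ∀ s : ℕ, (∀ u v : ℤ, -s ≤ u → u ≤ s → -s ≤ v → v ≤ s →
      ∃ m, FinRep n z m ((v - u : ℤ) + z * (-v : ℤ))) →
      (∀ u v : ℤ, -(s + 1) ≤ u → u ≤ s → -(s + 1) ≤ v → v ≤ s →
      ∃ m, FinRep n z m ((v - u : ℤ) + z * (-v : ℤ))) := by
    intro s h u v hu hu' hv hv'
    refine reduce (fun x => -(s + 1) ≤ x ∧ x ≤ s) ?_ (fun x => -s ≤ x ∧ x ≤ s) ?_ ?_ u v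
      ⟨hu, hu'⟩ ⟨hv, hv'⟩
    · intro u v hu hv
      have := key (v - u)
      omega
    · intro t u v ht hu hv hvt hw
      have h1 := key (v - u)
      have h2 := key (u - t)
      rw [← hvt] at h2
      omega
    · intro u v hu hv
      exact h u v hu.1 hu.2 hv.1 hv.2
  induction s with
  | zero =>
    have h0 : ∀ u v : ℤ, -(0 : ℕ) ≤ u → u ≤ (0 : ℕ) → -(0 : ℕ) ≤ v → v ≤ (0 : ℕ) →
        ∃ m, FinRep n z m ((v - u : ℤ) + z * (-v : ℤ)) := by
      intro u v h1 h2 h3 h4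
      obtain rfl : u = 0 := by omega
      obtain rfl : v = 0 := by omega
      exact ⟨0, by simpa using finRep_zero (by omega) z⟩
    exact ⟨h0, small 0 h0⟩
  | succ s ih =>
    have h0 : ∀ u v : ℤ, -(s + 1 : ℕ) ≤ u → u ≤ (s + 1 : ℕ) → -(s + 1 : ℕ) ≤ v →
        v ≤ (s + 1 : ℕ) → ∃ m, FinRep n z m ((v - u : ℤ) + z * (-v : ℤ)) := by
      intro u v hu hu' hv hv'
      refine reduce (fun x => -(s + 1 : ℕ) ≤ x ∧ x ≤ (s + 1 : ℕ)) ?_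
        (fun x => -(s + 1) ≤ x ∧ x ≤ s) ?_ ?_ u v ⟨hu, hu'⟩ ⟨hv, hv'⟩
      · intro u v hu hv
        have := key (v - u)
        omega
      · intro t u v ht hu hv hvt hw
        have h1 := key (v - u)
        have h2 := key (u - t)
        rw [← hvt] at h2
        omega
      · intro u v hu hv
        exact ih.2 u v hu.1 hu.2 hv.1 hv.2
    exact ⟨h0, small _ h0⟩

theorem exists_finRep (hz : z ^ 2 = D * z - n) (him : z.im ≠ 0) (hn : 2 ≤ n) (hD : D ≤ 1)
    {x : ℂ} (hx : x ∈ lattice z) : ∃ m, FinRep n z m x := by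
  rcases hD.lt_or_eq with h | rfl
  · exact finRep_of_nonpos hz him hn (by omega) hx
  · obtain ⟨p, q, rfl⟩ := hx
    obtain ⟨m, hm⟩ := (finRep_box hz hn (p.natAbs + q.natAbs)).1 (-q - p) (-q)
      (by omega) (by omega) (by omega) (by omega)
    refine ⟨m, ?_⟩
    convert hm using 2 <;> simp

theorem lattice_neg (z : ℂ) : lattice (-z) = lattice z := by
  ext x
  constructor <;> rintro ⟨p, q, rfl⟩ <;> exact ⟨p, -q, by push_cast; ring⟩

/-- The base `-z` has trace `-D ≤ 0`, so every lattice point has a finite string there; its even and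
odd positions contribute `u` and `-v` in base `z`. -/
theorem lattice_eq_sub (hz : z ^ 2 = D * z - n) (him : z.im ≠ 0) (hn : 2 ≤ n) (hD : 0 ≤ D)
    {x : ℂ} (hx : x ∈ lattice z) :
    ∃ m u v, FinRep n z m u ∧ FinRep n z m v ∧ x = u - v := by
  rw [← lattice_neg] at hx
  obtain ⟨m, d, hd, rfl⟩ := finRep_of_nonpos (n := n) (D := -D) (z := -z)
    (by push_cast; linear_combination hz) (by simpa using him) hn (by omega) hx
  refine ⟨m, _, _, ⟨fun i => if Even i then d i else 0, fun i => ?_, rfl⟩,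
    ⟨fun i => if Even i then 0 else d i, fun i => ?_, rfl⟩, ?_⟩
  · dsimp only
    split_ifs
    · exact hd i
    · omega
  · dsimp only
    split_ifs
    · omega
    · exact hd i
  · rw [← Finset.sum_sub_distrib]
    refine Finset.sum_congr rfl fun i _ => ?_
    by_cases h : Even i
    · simp [h]
    · simp [h, (Nat.not_even_iff_odd.1 h).neg_pow]

theorem lattice_eq_zero (him : z.im ≠ 0) {p q : ℤ} (h : (p + z * q : ℂ) = 0) :
    p = 0 ∧ q = 0 := by
  have h1 := congrArg Complex.im h
  simp [him] at h1
  subst h1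
  simpa using h

/-- The point `y = 1 - D + z` satisfies `y = (n + 1 - D) + z * y`, and `n + 1 - D` is a legitimate
digit because `2 ≤ D ≤ n`. Division therefore returns `y` forever. -/
theorem not_finRep (hz : z ^ 2 = D * z - n) (him : z.im ≠ 0) (hD : 2 ≤ D) (m : ℕ) :
    ¬ FinRep n z m ((1 - D : ℤ) + z * (1 : ℤ)) := by
  have hlt := sq_lt_four_mul hz him
  have hDn : D ≤ n := by nlinarith [sq_nonneg (D - 2)]
  induction m with
  | zero =>
    rintro ⟨d, -, h⟩
    have := lattice_eq_zero him (h.trans (by simp))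
    omega
  | succ m ih =>
    intro h
    obtain ⟨d, hd, w, hw, h⟩ := h.uncons
    obtain ⟨p, q, hpq⟩ := hw.mem_lattice hz
    have h0 : ((n + 1 - D - d + n * (q - 1) : ℤ) + z * (1 - D - p + (1 - q) * D : ℤ) : ℂ) = 0 := by
      rw [hpq] at h
      push_cast at h ⊢
      linear_combination h + (q : ℂ) * hz
    obtain ⟨h1, h2⟩ := lattice_eq_zero him h0
    -- Both `d` and `n + 1 - D` lie in `[0, n - 1]`, so their difference is a multiple of `n` only
    -- if it vanishes.
    have hq : q = 1 := by
      by_contra hq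
      rcases lt_or_gt_of_ne hq with hq | hq <;> nlinarith
    subst hq
    obtain rfl : p = 1 - D := by linarith
    exact ih (hpq ▸ hw)

end Quadratic
end ComplexBase

/-! ### Infinite digit series and compactness -/

namespace ComplexBase

/-- Digit sequences with no nonzero digit above position `L`. -/
def digitBox (n : ℕ) (L : ℤ) : Set (ℤ → ℕ) :=
  {a | (∀ i, a i < n) ∧ ∀ i, L < i → a i = 0}

/-- The value of a digit sequence. -/
noncomputable def value (z : ℂ) (a : ℤ → ℕ) : ℂ := ∑' i : ℤ, (a i : ℂ) * z ^ i

/-- The points having a representation without digits at nonnegative positions. -/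
def fracPart (n : ℕ) (z : ℂ) : Set ℂ :=
  {x | ∃ a, (∀ i, 0 ≤ i → a i = 0) ∧ IsRepresentation n z a x}

section Series

variable {n : ℕ} {z : ℂ} {a b : ℤ → ℕ} {x y : ℂ}

theorem summable_digit_bound (n : ℕ) {r : ℝ} (hr : 1 < r) (L : ℤ) :
    Summable fun i : ℤ => if i ≤ L then (n : ℝ) * r ^ i else 0 := by
  have hinj : Function.Injective fun j : ℕ => L - (j : ℤ) := fun i j h => by
    simpa using h
  rw [← hinj.summable_iff]
  · have h : ((fun i : ℤ => if i ≤ L then (n : ℝ) * r ^ i else 0) ∘ fun j : ℕ => L - (j : ℤ)) =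
        fun j : ℕ => n * r ^ L * r⁻¹ ^ j := by
      ext j
      have : (L - (j : ℤ)) ≤ L := by omega
      simp only [Function.comp_apply, this, if_true]
      rw [zpow_sub₀ (by positivity), zpow_natCast, inv_pow]
      ring
    rw [h]
    exact (summable_geometric_of_lt_one (by positivity) (inv_lt_one_of_one_lt₀ hr)).mul_left _
  · intro i hi
    rw [if_neg]
    intro hle
    exact hi ⟨(L - i).toNat, by simp only; omega⟩

theorem norm_digit_le {L : ℤ} (ha : a ∈ digitBox n L) (i : ℤ) :
    ‖(a i : ℂ) * z ^ i‖ ≤ if i ≤ L then (n : ℝ) * ‖z‖ ^ i else 0 := by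
  split_ifs with h
  · rw [norm_mul, norm_zpow, Complex.norm_natCast]
    have : (a i : ℝ) ≤ n := by exact_mod_cast (ha.1 i).le
    gcongr
  · simp [ha.2 i (by omega)]

theorem isRepresentation_value (hz : 1 < ‖z‖) {L : ℤ} (ha : a ∈ digitBox n L) :
    IsRepresentation n z a (value z a) :=
  ⟨⟨ha.1, L, ha.2⟩,
    (Summable.of_norm_bounded (summable_digit_bound n hz L) (norm_digit_le ha)).hasSum⟩

theorem IsRepresentation.unique (hx : IsRepresentation n z a x) (hy : IsRepresentation n z a y) :
    x = y :=
  hx.2.unique hy.2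

theorem isCompact_digitBox (n : ℕ) (L : ℤ) : IsCompact (digitBox n L) := by
  have : digitBox n L = Set.univ.pi fun i => {d | d < n ∧ (L < i → d = 0)} := by
    ext a
    simp [digitBox, Set.mem_pi, forall_and]
  rw [this]
  exact isCompact_univ_pi fun i =>
    ((Set.finite_lt_nat n).subset fun d hd => hd.1).isCompact

/-- The digit box is a product of finite sets, and a summable bound independent of the sequence
makes the value continuous on it. -/
theorem isCompact_values (n : ℕ) (hz : 1 < ‖z‖) (L : ℤ) :
    IsCompact (value z '' digitBox n L) := by
  refine (isCompact_digitBox n L).image_of_continuousOn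
    (continuousOn_tsum (fun i => ?_) (summable_digit_bound n hz L)
      fun i a ha => norm_digit_le ha i)
  have h1 : Continuous fun a : ℤ → ℕ => ((a i : ℕ) : ℂ) :=
    continuous_of_discreteTopology.comp (continuous_apply i)
  exact (h1.mul continuous_const).continuousOn

theorem fracPart_eq_values (hz : 1 < ‖z‖) : fracPart n z = value z '' digitBox n (-1) := by
  ext x
  constructor
  · rintro ⟨a, ha, hx⟩
    have hbox : a ∈ digitBox n (-1) := ⟨hx.1.1, fun i hi => ha i (by omega)⟩
    exact ⟨a, hbox, (isRepresentation_value hz hbox).unique hx⟩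
  · rintro ⟨a, ha, rfl⟩
    exact ⟨a, fun i hi => ha.2 i (by omega), isRepresentation_value hz ha⟩

theorem isCompact_fracPart (n : ℕ) (hz : 1 < ‖z‖) : IsCompact (fracPart n z) :=
  fracPart_eq_values (n := n) hz ▸ isCompact_values n hz (-1)

theorem IsRepresentation.shift (hz : z ≠ 0) (hx : IsRepresentation n z a x) (j : ℤ) :
    IsRepresentation n z (fun i => a (i - j)) (z ^ j * x) := by
  obtain ⟨⟨h1, N, h2⟩, h3⟩ := hx
  refine ⟨⟨fun i => h1 _, N + j, fun i hi => h2 _ (by omega)⟩, ?_⟩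
  have h := ((Equiv.subRight j).hasSum_iff.2 h3).mul_left (z ^ j)
  refine h.congr_fun fun i => ?_
  simp only [Function.comp_apply, Equiv.subRight_apply]
  rw [zpow_sub₀ hz]
  field_simp

/-- Splitting a representation into its integer and fractional parts. -/
theorem IsRepresentation.split (hz : 1 < ‖z‖) (hx : IsRepresentation n z a x) :
    ∃ l, IsRepresentation n z (fun i => if 0 ≤ i then a i else 0) l ∧
      IsRepresentation n z (fun i => if 0 ≤ i then 0 else a i) (x - l) := by
  obtain ⟨⟨h1, N, h2⟩, h3⟩ := hx
  have hbox : (fun i => if 0 ≤ i then a i else 0) ∈ digitBox n N := by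
    refine ⟨fun i => ?_, fun i hi => ?_⟩
    · have := h1 i
      dsimp only
      split_ifs <;> omega
    · simp [h2 i hi]
  refine ⟨_, isRepresentation_value hz hbox, ⟨fun i => ?_, N, fun i hi => ?_⟩, ?_⟩
  · have := h1 i
    dsimp only
    split_ifs <;> omega
  · simp [h2 i hi]
  · refine (h3.sub (isRepresentation_value hz hbox).2).congr_fun fun i => ?_
    beta_reduce
    split_ifs <;> simp

theorem IsRepresentation.combine (hx : IsRepresentation n z a x) (hy : IsRepresentation n z b y)
    (ha : ∀ i, i < 0 → a i = 0) (hb : ∀ i, 0 ≤ i → b i = 0) :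
    IsRepresentation n z (fun i => a i + b i) (x + y) := by
  refine ⟨⟨fun i => ?_, ?_⟩, ?_⟩
  · rcases lt_or_ge i 0 with h | h
    · simpa [ha i h] using hy.1.1 i
    · simpa [hb i h] using hx.1.1 i
  · obtain ⟨N, hN⟩ := hx.1.2
    obtain ⟨M, hM⟩ := hy.1.2
    refine ⟨max N M, fun i hi => ?_⟩
    beta_reduce
    rw [hN i (by omega), hM i (by omega)]
  · refine (hx.2.add hy.2).congr_fun fun i => ?_
    push_cast
    ring

/-- A digit string of length `m`, placed at the positions `-k, …, m - k - 1`. -/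
theorem FinRep.exists_isRepresentation (hz : z ≠ 0) {m : ℕ} (h : FinRep n z m x) (k : ℤ) :
    ∃ a ∈ digitBox n (m - k), (∀ i, i < -k → a i = 0) ∧ IsRepresentation n z a (z ^ (-k) * x) := by
  obtain ⟨d, hd, rfl⟩ := h
  have h0 : IsRepresentation n z (fun i => if 0 ≤ i ∧ i < m then d i.toNat else 0)
      (∑ i ∈ Finset.range m, (d i : ℂ) * z ^ i) := by
    refine ⟨⟨fun i => ?_, m, fun i hi => ?_⟩, ?_⟩
    · have := hd i.toNat
      dsimp only
      split_ifs <;> omega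
    · beta_reduce
      rw [if_neg (by omega)]
    · rw [← (Nat.cast_injective (R := ℤ)).hasSum_iff]
      · convert hasSum_sum_of_ne_finset_zero (s := Finset.range m)
          (f := fun i : ℕ => if i < m then (d i : ℂ) * z ^ i else 0) ?_ using 1
        · ext i
          simp
        · exact Finset.sum_congr rfl fun i hi => by simp [Finset.mem_range.1 hi]
        · intro i hi
          simpa using fun h => absurd h (by simpa using hi)
        · infer_instance
      · intro i hi
        beta_reduce
        rw [if_neg]
        · simp
        · rintro ⟨h, -⟩
          exact hi ⟨i.toNat, by simp [h]⟩
  refine ⟨_, ⟨?_, ?_⟩, ?_, h0.shift hz (-k)⟩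
  · exact (h0.shift hz (-k)).1.1
  · intro i hi
    rw [if_neg (by omega)]
  · intro i hi
    rw [if_neg (by omega)]

theorem mem_integerPart_iff (hz : z ≠ 0) :
    x ∈ integerPart n z ↔ ∃ m, FinRep n z m x := by
  constructor
  · rintro ⟨a, ha, ⟨h1, N, h2⟩, h3⟩
    refine ⟨(N + 1).toNat, fun i => a i, fun i => h1 _, ?_⟩
    rw [← (Nat.cast_injective (R := ℤ)).hasSum_iff] at h3
    · refine h3.unique ?_
      convert hasSum_sum_of_ne_finset_zero (s := Finset.range (N + 1).toNat)
          (f := fun i : ℕ => (a i : ℂ) * z ^ i) ?_ using 1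
      · ext i
        simp
      · intro i hi
        rw [Finset.mem_range] at hi
        rw [h2 i (by omega)]
        simp
      · infer_instance
    · intro i hi
      rw [ha i, Nat.cast_zero, zero_mul]
      by_contra h
      exact hi ⟨i.toNat, Int.toNat_of_nonneg (by omega)⟩
  · rintro ⟨m, hm⟩
    obtain ⟨a, -, ha, h⟩ := hm.exists_isRepresentation hz 0
    exact ⟨a, by simpa using ha, by simpa using h⟩

/-- Multiplying a fractional part by the base and removing the leading digit. -/
theorem IsRepresentation.leading (hz : 1 < ‖z‖) (hx : IsRepresentation n z a x)
    (ha : ∀ i, 0 ≤ i → a i = 0) : z * x - a (-1) ∈ fracPart n z := by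
  have hz0 : z ≠ 0 := by rintro rfl; norm_num at hz
  have h := hx.shift hz0 1
  obtain ⟨l, hl, hxl⟩ := h.split hz
  have : l = a (-1) := by
    refine hl.2.unique ?_
    convert hasSum_single (0 : ℤ) ?_ using 1
    · simp
    · intro i hi
      by_cases h0 : 0 ≤ i
      · simp [h0, ha (i - 1) (by omega)]
      · simp [h0]
  rw [this, zpow_one] at hxl
  exact ⟨_, fun i hi => by simp [hi], hxl⟩

end Series
end ComplexBase

/-! ### Measure of overlaps -/

namespace ComplexBase

theorem volume_image_mul (z : ℂ) (s : Set ℂ) :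
    volume ((fun x => z * x) '' s) = ENNReal.ofReal (Complex.normSq z) * volume s := by
  have h := Measure.addHaar_image_linearMap (volume : Measure ℂ) (Algebra.lmul ℝ ℂ z) s
  rw [← Algebra.norm_apply, Algebra.norm_complex_apply, abs_of_nonneg (Complex.normSq_nonneg z)] at h
  exact h

theorem volume_image_affine_eq_zero (c w : ℂ) {s : Set ℂ} (hs : volume s = 0) :
    volume ((fun x => c * (w + x)) '' s) = 0 := by
  refine addHaar_image_eq_zero_of_differentiableOn_of_addHaar_eq_zero volume ?_ hs
  exact Differentiable.differentiableOn (by fun_prop)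

theorem volume_image_add (c : ℂ) (s : Set ℂ) : volume ((fun x => c + x) '' s) = volume s := by
  rw [Set.image_add_left, measure_preimage_add]

section Tiling

variable {n : ℕ} {z : ℂ}

theorem one_lt_norm (hn : 2 ≤ n) (hN : Complex.normSq z = n) : 1 < ‖z‖ := by
  have : (2 : ℝ) ≤ n := by exact_mod_cast hn
  rw [Complex.normSq_eq_norm_sq] at hN
  nlinarith [norm_nonneg z]

theorem measurableSet_add_fracPart (hz : 1 < ‖z‖) (c : ℂ) :
    MeasurableSet ((fun x => c + x) '' fracPart n z) :=
  ((isCompact_fracPart n hz).image (continuous_const_add c)).measurableSet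

/-- Translates of the fractional part by distinct digits overlap in a null set. -/
theorem volume_digit_inter (hn : 2 ≤ n) (hN : Complex.normSq z = n) {d e : ℕ} (hd : d < n)
    (he : e < n) (hde : d ≠ e) :
    volume ((fun x => (d : ℂ) + x) '' fracPart n z ∩ (fun x => (e : ℂ) + x) '' fracPart n z) = 0 := by
  have hz := one_lt_norm hn hN
  set K := fracPart n z with hK
  have hfin : volume K ≠ ⊤ := (isCompact_fracPart n hz).measure_lt_top.ne
  set T : ℕ → Set ℂ := fun d => (fun x => (d : ℂ) + x) '' K with hT
  have hTvol : ∀ d, volume (T d) = volume K := fun d => volume_image_add _ _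
  -- The leading digit selects the translate. Points of `T d` are already covered, so only `T e \ T
  -- d` is needed from `T e`; comparing volumes then makes the overlap null.
  have hcover : (fun x => z * x) '' K ⊆
      (⋃ f ∈ (Finset.range n).erase e, T f) ∪ (T e \ T d) := by
    rintro _ ⟨x, ⟨a, ha, hx⟩, rfl⟩
    have hmem : z * x ∈ T (a (-1)) := ⟨_, hx.leading hz ha, by simp⟩
    by_cases hae : a (-1) = e
    · by_cases hxd : z * x ∈ T d
      · exact Or.inl (Set.mem_biUnion (by simp [hde, hd]) hxd)
      · exact Or.inr ⟨hae ▸ hmem, hxd⟩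
    · refine Or.inl (Set.mem_biUnion ?_ hmem)
      simpa [hae] using hx.1.1 (-1)
  have h1 : volume ((fun x => z * x) '' K) = n * volume K := by
    rw [volume_image_mul, hN, ENNReal.ofReal_natCast]
  have h2 : (n : ENNReal) * volume K ≤ (n - 1 : ℕ) * volume K + volume (T e \ T d) := by
    rw [← h1]
    refine (measure_mono hcover).trans ((measure_union_le _ _).trans ?_)
    gcongr
    refine (measure_biUnion_finset_le _ _).trans ?_
    simp [hTvol, he]
  have h3 : volume (T e \ T d) + volume (T e ∩ T d) = volume K := by
    rw [measure_sdiff_add_inter _ (measurableSet_add_fracPart hz _), hTvol]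
  have h4 : (n : ENNReal) = (n - 1 : ℕ) + 1 := by
    exact_mod_cast (show n = n - 1 + 1 by omega)
  rw [h4, add_mul, one_mul] at h2
  have h5 : volume K ≤ volume (T e \ T d) :=
    (ENNReal.add_le_add_iff_left (ENNReal.mul_ne_top (by simp) hfin)).1 h2
  have h6 : volume (T e ∩ T d) = 0 := by
    rw [← h3] at h5
    have hne : volume (T e \ T d) ≠ ⊤ := fun h => hfin (by rw [← h3, h, top_add])
    simpa using (ENNReal.add_le_add_iff_left hne).1 (h5.trans (add_zero _).ge)
  rwa [Set.inter_comm]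

/-- The points with at least two representations. -/
def ambiguous (n : ℕ) (z : ℂ) : Set ℂ :=
  {x | ∃ a b, IsRepresentation n z a x ∧ IsRepresentation n z b x ∧ a ≠ b}

theorem volume_ambiguous (hn : 2 ≤ n) {D : ℤ} (hq : z ^ 2 = D * z - n) (him : z.im ≠ 0) :
    volume (ambiguous n z) = 0 := by
  have hN := normSq_eq hq him
  have hz := one_lt_norm hn hN
  have hz0 : z ≠ 0 := by rintro rfl; simp at him
  have hcount := lattice_countable z
  have : ambiguous n z ⊆ ⋃ j : ℤ, ⋃ l ∈ lattice z, ⋃ d : Fin n, ⋃ e ∈ {e : Fin n | d ≠ e},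
      (fun x => z ^ j * (z * l + x)) '' ((fun x => ((d : ℕ) : ℂ) + x) '' fracPart n z ∩
        (fun x => ((e : ℕ) : ℂ) + x) '' fracPart n z) := by
    rintro x ⟨a, b, ha, hb, hab⟩
    obtain ⟨N, hN⟩ := ha.1.2
    obtain ⟨M, hM⟩ := hb.1.2
    obtain ⟨j, hj, hjmax⟩ := Int.exists_greatest_of_bdd (P := fun i => a i ≠ b i)
      ⟨max N M, fun i hi => by
        by_contra hlt
        exact hi (by rw [hN i (by omega), hM i (by omega)])⟩
      (by
        by_contra h
        push Not at h
        exact hab (funext h))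
    -- The highest differing position `j` moves to `-1`, so the two integer parts coincide and the
    -- leading fractional digits differ.
    obtain ⟨l, hl, hla⟩ := (ha.shift hz0 (-j - 1)).split hz
    obtain ⟨l', hl', hlb⟩ := (hb.shift hz0 (-j - 1)).split hz
    have hll : l = l' := by
      refine hl.unique ?_
      convert hl' using 2 with i
      by_cases h : 0 ≤ i
      · simp only [h, if_true]
        by_contra hne
        have := hjmax _ hne
        omega
      · simp [h]
    subst hll
    have hlat : l ∈ lattice z := by
      obtain ⟨m, hm⟩ := (mem_integerPart_iff hz0).1 ⟨_, fun i hi => if_neg (by omega), hl⟩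
      exact hm.mem_lattice hq
    have h1 := hla.leading hz (fun i hi => if_pos hi)
    have h2 := hlb.leading hz (fun i hi => if_pos hi)
    have hidx : (-1 : ℤ) - (-j - 1) = j := by ring
    simp only [show ¬ (0 : ℤ) ≤ -1 by norm_num, if_false, hidx] at h1 h2
    simp only [Set.mem_iUnion]
    refine ⟨j, l, hlat, ⟨a j, ha.1.1 j⟩, ⟨b j, hb.1.1 j⟩, by simpa using hj,
      z * (z ^ (-j - 1) * x - l), ⟨⟨_, h1, by simp⟩, ⟨_, h2, by simp⟩⟩, ?_⟩
    have h3 : z ^ (-j - 1) = z⁻¹ * (z ^ j)⁻¹ := by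
      rw [zpow_sub₀ hz0, zpow_neg, zpow_one]
      field_simp
    have h4 := zpow_ne_zero j hz0
    simp only [h3]
    field_simp
    ring
  refine measure_mono_null this (measure_iUnion_null fun j => (measure_biUnion_null_iff hcount).2
    fun l _ => measure_iUnion_null fun d => (measure_biUnion_null_iff (Set.to_countable _)).2
    fun e hde => ?_)
  exact volume_image_affine_eq_zero _ _
    (volume_digit_inter hn hN d.2 e.2 fun h => hde (Fin.ext h))

/-- Let `y` be the nonrepresentable point and `k` a fractional part. Surjectivity gives `y + k = l +
k'` with `l ≠ y`. Writing `y - l = u - v` yields `u + k = v + k'`, a point with two representations.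
Hence the fractional part lies in countably many translates of a null set. -/
theorem not_surjective (hn : 2 ≤ n) {D : ℤ} (hq : z ^ 2 = D * z - n) (him : z.im ≠ 0)
    (hD : 2 ≤ D) : ¬ ∀ x : ℂ, ∃ a, IsRepresentation n z a x := by
  intro hsurj
  have hz := one_lt_norm hn (normSq_eq hq him)
  have hz0 : z ≠ 0 := by rintro rfl; simp at him
  have hcount := lattice_countable z
  have hsplit : ∀ x : ℂ, ∃ l, (∃ m, FinRep n z m l) ∧ x - l ∈ fracPart n z := fun x => by
    obtain ⟨a, ha⟩ := hsurj x
    obtain ⟨l, hl, hxl⟩ := ha.split hz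
    exact ⟨l, (mem_integerPart_iff hz0).1 ⟨_, fun i hi => if_neg (by omega), hl⟩,
      _, fun i hi => if_pos hi, hxl⟩
  set y : ℂ := (1 - D : ℤ) + z * (1 : ℤ) with hy
  have hylat : y ∈ lattice z := ⟨_, _, rfl⟩
  have hK : volume (fracPart n z) = 0 := by
    have hsub : fracPart n z ⊆ ⋃ w ∈ lattice z, (fun x => 1 * (w + x)) '' ambiguous n z := by
      intro k hk
      obtain ⟨l, ⟨m, hl⟩, hl'⟩ := hsplit (y + k)
      have hne : y - l ≠ 0 := fun h => not_finRep hq him hD m (by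
        rw [← hy, sub_eq_zero.1 h]
        exact hl)
      obtain ⟨m', u, v, hu, hv, huv⟩ := lattice_eq_sub hq him hn (by omega)
        (lattice_sub hylat (hl.mem_lattice hq))
      obtain ⟨α, hα, hα'⟩ := (mem_integerPart_iff hz0).2 ⟨_, hu⟩
      obtain ⟨β, hβ, hβ'⟩ := (mem_integerPart_iff hz0).2 ⟨_, hv⟩
      obtain ⟨κ, hκ, hκ'⟩ := hk
      obtain ⟨γ, hγ, hγ'⟩ := hl'
      have h1 := hα'.combine hκ' hα hκ
      have h2 := hβ'.combine hγ' hβ hγ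
      have h3 : v + (y + k - l) = u + k := by linear_combination huv
      rw [h3] at h2
      have hmem : u + k ∈ ambiguous n z := by
        refine ⟨_, _, h1, h2, fun heq => hne ?_⟩
        have hαβ : α = β := by
          ext i
          have := congrFun heq i
          rcases lt_or_ge i 0 with h | h
          · rw [hα i h, hβ i h]
          · simpa [hκ i h, hγ i h] using this
        subst hαβ
        rw [huv, hα'.unique hβ', sub_self]
      refine Set.mem_biUnion (x := 0 - u)
        (lattice_sub ⟨0, 0, by simp⟩ (hu.mem_lattice hq)) ⟨u + k, hmem, by simp⟩
    exact measure_mono_null hsub ((measure_biUnion_null_iff hcount).2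
      fun w _ => volume_image_affine_eq_zero _ _ (volume_ambiguous hn hq him))
  have huniv : (Set.univ : Set ℂ) ⊆ ⋃ l ∈ lattice z, (fun x => 1 * (l + x)) '' fracPart n z := by
    intro x _
    obtain ⟨l, ⟨m, hl⟩, hxl⟩ := hsplit x
    exact Set.mem_biUnion (hl.mem_lattice hq) ⟨_, hxl, by simp⟩
  have h0 : volume (Set.univ : Set ℂ) = 0 := measure_mono_null huniv
    ((measure_biUnion_null_iff hcount).2 fun w _ => volume_image_affine_eq_zero _ _ hK)
  exact isOpen_univ.measure_ne_zero volume Set.univ_nonempty h0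

end Tiling

/-! ### Existence of representations for `D ≤ 1` -/

section Covering

variable {n : ℕ} {D : ℤ} {z : ℂ}

theorem exists_lattice_near (him : z.im ≠ 0) (w : ℂ) :
    ∃ l ∈ lattice z, ‖w - l‖ ≤ 1 + ‖z‖ := by
  set t : ℝ := w.im / z.im with ht
  set s : ℝ := w.re - t * z.re with hs
  have hw : w = s + z * t := by
    apply Complex.ext
    · simp [hs]
      ring
    · simp [ht]
      field_simp
  refine ⟨⌊s⌋ + z * ⌊t⌋, ⟨_, _, rfl⟩, ?_⟩
  have h : w - (⌊s⌋ + z * ⌊t⌋) = ((Int.fract s : ℝ) : ℂ) + z * ((Int.fract t : ℝ) : ℂ) := by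
    rw [hw, Int.fract, Int.fract]
    push_cast
    ring
  rw [h]
  refine (norm_add_le _ _).trans ?_
  rw [norm_mul, Complex.norm_of_nonneg (Int.fract_nonneg _),
    Complex.norm_of_nonneg (Int.fract_nonneg _)]
  have h1 := (Int.fract_lt_one s).le
  have h2 := (Int.fract_lt_one t).le
  nlinarith [norm_nonneg z]

theorem finite_lattice_ball (him : z.im ≠ 0) (R : ℝ) : {l | l ∈ lattice z ∧ ‖l‖ ≤ R}.Finite := by
  obtain ⟨B, hB⟩ := exists_int_gt (R / |z.im|)
  obtain ⟨A, hA⟩ := exists_int_gt (R + |z.re| * B)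
  refine ((Set.finite_Icc (-A) A).prod (Set.finite_Icc (-B) B)).image
    (fun p : ℤ × ℤ => (p.1 + z * p.2 : ℂ)) |>.subset ?_
  rintro _ ⟨⟨p, q, rfl⟩, hR⟩
  refine ⟨(p, q), ?_, rfl⟩
  have h1 := (Complex.abs_im_le_norm _).trans hR
  have h2 := (Complex.abs_re_le_norm _).trans hR
  simp only [Complex.add_im, Complex.intCast_im, Complex.mul_im, Complex.intCast_re, mul_zero,
    zero_add, Complex.add_re, Complex.mul_re, sub_zero, abs_mul] at h1 h2
  have hq : |(q : ℝ)| < B := by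
    refine lt_of_le_of_lt ?_ hB
    rw [le_div_iff₀ (abs_pos.2 him)]
    linarith
  have hp : |(p : ℝ)| < A := by
    refine lt_of_le_of_lt ?_ hA
    have : |(p : ℝ)| ≤ |p + z.re * q| + |z.re * q| := by
      simpa using abs_sub (p + z.re * q : ℝ) (z.re * q)
    rw [abs_mul] at this
    have : |z.re| * |(q : ℝ)| ≤ |z.re| * B := by gcongr
    linarith
  rw [← Int.cast_abs] at hq hp
  have hq' : |q| < B := by exact_mod_cast hq
  have hp' : |p| < A := by exact_mod_cast hp
  rw [abs_lt] at hq' hp'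
  exact ⟨⟨hp'.1.le, hp'.2.le⟩, ⟨hq'.1.le, hq'.2.le⟩⟩

/-- The length of a representation of a lattice point grows at most logarithmically. -/
theorem exists_finRep_length (hq : z ^ 2 = D * z - n) (him : z.im ≠ 0) (hn : 2 ≤ n) (hD : D ≤ 1)
    (A C : ℝ) : ∃ L : ℕ, ∀ (k : ℕ) (l : ℂ), l ∈ lattice z → ‖l‖ ≤ ‖z‖ ^ k * A + C →
      FinRep n z (k + L) l := by
  have hz := one_lt_norm hn (normSq_eq hq him)
  -- This `B` makes the bound `‖z‖ ^ k * A + B` pass to the quotient with `k` lowered by one,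
  -- despite the subtracted digit. After `k` divisions only finitely many lattice points remain.
  set B : ℝ := max C (n / (‖z‖ - 1)) with hB
  have hBz : B + n ≤ ‖z‖ * B := by
    have : n / (‖z‖ - 1) ≤ B := le_max_right _ _
    rw [div_le_iff₀ (by linarith)] at this
    linarith
  have hfin := finite_lattice_ball him (A + B)
  have hbound : ∃ L, ∀ l ∈ {l | l ∈ lattice z ∧ ‖l‖ ≤ A + B}, FinRep n z L l := by
    choose! m hm using fun (l : ℂ) (hl : l ∈ lattice z) => exists_finRep hq him hn hD hl
    obtain ⟨L, hL⟩ := (hfin.image m).bddAbove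
    exact ⟨L, fun l hl => (hm l hl.1).mono (hL ⟨l, hl, rfl⟩)⟩
  obtain ⟨L, hL⟩ := hbound
  have key : ∀ (k : ℕ) (l : ℂ), l ∈ lattice z → ‖l‖ ≤ ‖z‖ ^ k * A + B →
      FinRep n z (k + L) l := by
    intro k
    induction k with
    | zero =>
      intro l hl hle
      rw [zero_add]
      exact hL l ⟨hl, by simpa using hle⟩
    | succ k ih =>
      intro l hl hle
      obtain ⟨p, q, rfl⟩ := hl
      obtain ⟨d, hd, h⟩ := lattice_divide hq hn p q
      rw [h] at hle ⊢
      set w : ℂ := ((q + p / n * D : ℤ) : ℂ) + z * ((-(p / n) : ℤ) : ℂ) with hw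
      rw [show k + 1 + L = k + L + 1 by ring]
      refine (ih w ⟨_, _, hw⟩ ?_).cons hd
      have h1 : ‖z * w‖ ≤ ‖d + z * w‖ + ‖(d : ℂ)‖ := by
        simpa using norm_sub_le (d + z * w) d
      rw [norm_mul, Complex.norm_natCast] at h1
      have h2 : (d : ℝ) ≤ n := by exact_mod_cast hd.le
      have h3 : ‖z‖ * ‖w‖ ≤ ‖z‖ * (‖z‖ ^ k * A + B) := by
        calc ‖z‖ * ‖w‖ ≤ ‖z‖ ^ (k + 1) * A + (B + n) := by linarith
          _ ≤ ‖z‖ ^ (k + 1) * A + ‖z‖ * B := by linarith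
          _ = _ := by ring
      exact le_of_mul_le_mul_left h3 (by linarith)
  exact ⟨L, fun k l hl hle => key k l hl (hle.trans (by gcongr; exact le_max_left _ _))⟩

/-- Lattice points `l k` near `z ^ k * x` have strings of length at most `k + L`, so all `z ^ (-k) *
l k` lie in one compact set of values, which contains their limit `x`. -/
theorem exists_isRepresentation (hq : z ^ 2 = D * z - n) (him : z.im ≠ 0) (hn : 2 ≤ n)
    (hD : D ≤ 1) (x : ℂ) : ∃ a, IsRepresentation n z a x := by
  have hz := one_lt_norm hn (normSq_eq hq him)
  have hz0 : z ≠ 0 := by rintro rfl; simp at him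
  obtain ⟨L, hL⟩ := exists_finRep_length hq him hn hD ‖x‖ (1 + ‖z‖)
  choose l hl hlx using fun k : ℕ => exists_lattice_near him (z ^ k * x)
  have hmem : ∀ k : ℕ, z ^ (-(k : ℤ)) * l k ∈ value z '' digitBox n L := fun k => by
    have hle : ‖l k‖ ≤ ‖z‖ ^ k * ‖x‖ + (1 + ‖z‖) := by
      have h1 : ‖l k‖ ≤ ‖z ^ k * x‖ + ‖z ^ k * x - l k‖ := by
        simpa using norm_sub_le (z ^ k * x) (z ^ k * x - l k)
      rw [norm_mul, norm_pow] at h1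
      linarith [hlx k]
    obtain ⟨a, ha, -, hrep⟩ := (hL k (l k) (hl k) hle).exists_isRepresentation hz0 k
    have : ((k + L : ℕ) : ℤ) - k = L := by push_cast; ring
    rw [this] at ha
    exact ⟨a, ha, (isRepresentation_value hz ha).unique hrep⟩
  have hlim : Filter.Tendsto (fun k : ℕ => z ^ (-(k : ℤ)) * l k) Filter.atTop (nhds x) := by
    rw [tendsto_iff_norm_sub_tendsto_zero]
    have h0 : Filter.Tendsto (fun k : ℕ => (‖z‖⁻¹) ^ k * (1 + ‖z‖)) Filter.atTop (nhds 0) := by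
      simpa using (tendsto_pow_atTop_nhds_zero_of_lt_one (by positivity)
        (inv_lt_one_of_one_lt₀ hz)).mul_const (1 + ‖z‖)
    refine squeeze_zero (fun _ => norm_nonneg _) (fun k => ?_) h0
    have : z ^ (-(k : ℤ)) * l k - x = -(z⁻¹ ^ k * (z ^ k * x - l k)) := by
      rw [zpow_neg, zpow_natCast, inv_pow]
      field_simp
      ring
    rw [this, norm_neg, norm_mul, norm_pow, norm_inv]
    gcongr
    exact hlx k
  obtain ⟨a, ha, rfl⟩ := (isCompact_values n hz L).isClosed.mem_of_tendsto hlim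
    (Filter.Eventually.of_forall hmem)
  exact ⟨a, isRepresentation_value hz ha⟩

theorem isProper_iff (hq : z ^ 2 = D * z - n) (him : z.im ≠ 0) (hn : 2 ≤ n) :
    IsProper n z ↔ D ≤ 1 := by
  constructor
  · intro h
    by_contra hD
    exact not_surjective hn hq him (by omega) h.1
  · intro hD
    refine ⟨exists_isRepresentation hq him hn hD, ambiguous n z, volume_ambiguous hn hq him,
      fun x hx a b ha hb => ?_⟩
    by_contra hab
    exact hx ⟨a, b, ha, hb, hab⟩

theorem integerPart_eq_lattice_iff (hq : z ^ 2 = D * z - n) (him : z.im ≠ 0) (hn : 2 ≤ n) :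
    integerPart n z = lattice z ↔ D ≤ 1 := by
  have hz0 : z ≠ 0 := by rintro rfl; simp at him
  constructor
  · intro h
    by_contra hD
    have hy : ((1 - D : ℤ) + z * (1 : ℤ) : ℂ) ∈ lattice z := ⟨_, _, rfl⟩
    rw [← h, mem_integerPart_iff hz0] at hy
    obtain ⟨m, hm⟩ := hy
    exact not_finRep hq him (by omega) m hm
  · intro hD
    ext x
    rw [mem_integerPart_iff hz0]
    exact ⟨fun ⟨m, hm⟩ => hm.mem_lattice hq, exists_finRep hq him hn hD⟩

end Covering

end ComplexBase

theorem mainTheorem1 (n : ℕ) (hn : 2 ≤ n) (D : ℤ) (hD : D ^ 2 < 4 * (n : ℤ)) (z : ℂ)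
    (hz : z = (D : ℂ) / 2 + Complex.I * (Real.sqrt ((n : ℝ) - ((D : ℝ) / 2) ^ 2) : ℂ) ∨
      z = (D : ℂ) / 2 - Complex.I * (Real.sqrt ((n : ℝ) - ((D : ℝ) / 2) ^ 2) : ℂ)) :
    z ^ 2 = (D : ℂ) * z - (n : ℂ) ∧
      (ComplexBase.IsProper n z ↔ D ≤ 1) ∧
      (ComplexBase.integerPart n z = ComplexBase.lattice z ↔ D ≤ 1) := by
  have hD' : (D : ℝ) ^ 2 < 4 * n := by exact_mod_cast hD
  have hpos : 0 < (n : ℝ) - ((D : ℝ) / 2) ^ 2 := by nlinarith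
  set s := Real.sqrt ((n : ℝ) - ((D : ℝ) / 2) ^ 2) with hs
  have hs0 : 0 < s := Real.sqrt_pos.2 hpos
  have hsq : (s : ℂ) ^ 2 = n - (D / 2) ^ 2 := by
    have := Real.sq_sqrt hpos.le
    rw [← hs] at this
    exact_mod_cast congrArg (Complex.ofReal) this
  have hq : z ^ 2 = (D : ℂ) * z - (n : ℂ) := by
    rcases hz with rfl | rfl
    · linear_combination (s : ℂ) ^ 2 * Complex.I_sq - hsq
    · linear_combination (s : ℂ) ^ 2 * Complex.I_sq - hsq
  have him : z.im ≠ 0 := by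
    have h2 : ((D : ℂ) / 2).im = 0 := by simp
    rcases hz with rfl | rfl <;> simp [h2, hs0.ne']
  exact ⟨hq, ComplexBase.isProper_iff hq him hn, ComplexBase.integerPart_eq_lattice_iff hq him hn⟩
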